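/- Let $\mathfrak h$ be a finite dimensional real vector space, $I$ a finite set, and let $(H_i,L_i)_{i\in I}$ be a linear Coxeter system on $\mathfrak h$. That is, $H_i=\mathbb R_{\ge 0}h_i\subseteq\mathfrak h$ and $L_i=\mathbb R_{\ge 0}\alpha_i\subseteq\mathfrak h^*$ with $\alpha_i(h_i)=2$ such that: the closed chamber $\overline C=\{\lambda\in\mathfrak h^*\mid \lambda(h_i)\ge 0\ \forall i\in I\}$ spans $\mathfrak h^*$; its pairwise different faces of codimension one are the sets $\overline C\cap\{\lambda\mid\lambda(h_i)=0\}$, $i\in I$; and, with $C=\{\lambda\mid\lambda(h_i)>0\ \forall i\in I\}$ and $\mathcal W\subseteq GL(\mathfrak h^*)$ the group generated by the reflections $\sigma_i(\lambda)=\lambda-\lambda(h_i)\alpha_i$, one has $\sigma C\cap C=\emptyset$ for all $\sigma\in\mathcal W\setminus\{1\}$. The Tits cone is $X=\bigcup_{\sigma\in\mathcal W}\sigma\overline C$. For $J\subseteq I$ let $\mathcal W_J$ be the subgroup generated by the $\sigma_j$, $j\in J$, and put $\overline C(J)=\{\lambda\in\mathfrak h^*\mid\lambda(h_j)\ge 0\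 \forall j\in J\}$ and $X(J)=\bigcup_{\sigma\in\mathcal W_J}\sigma\overline C(J)$; in particular $\overline C(\emptyset)=X(\emptyset)=\mathfrak h^*$. For a convex cone $K$ containing $0$ let $\mathrm{Fa}(K)$ be the set of its nonempty faces, ordered by inclusion, and let $\dim K$ be the dimension of its linear hull; $\mathrm{ri}$ denotes the relative interior, and $K-L=\{x-y\mid x\in K,\ y\in L\}$. Let $Y\subseteq X$ be a $\mathcal W$-invariant convex cone containing $0$, and let $$\Upsilon=\{R\in\mathrm{Fa}(Y)\mid \mathrm{ri}(R)\cap\overline C\ne\emptyset\}.$$ For $R\in\Upsilon$ put $\upsilon_*(R)=\{i\in I\mid\sigma_i \text{ fixes } R \text{ pointwise}\}$ and $\upsilon^*(R)=\{i\in I\mid \sigma_iR=R\}\setminus\upsilon_*(R)$. For $R_1,R_2\in\Upsilon$ with $R_1\subseteq R_2$ let $[R_1,R_2]=\{R\in\mathrm{Fa}(Y)\mid R_1\subseteq R\subseteq R_2\}$. **Theorem.** Let $R_1,R_2\in\Upsilon$ with $R_1\subseteq R_2$, and set $J=\upsilon_*(R_1)\cap\upsilon^*(R_2)$. (a) The convex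 cone $R_2-R_1$ is a $\mathcal W_J$-invariant subcone of $X(J)$, and $$(R_2-R_1)\cap\overline C(J)=(R_2\cap\overline C)+(R_1-R_1)=(R_2\cap\overline C)-(R_1\cap\overline C).$$ (b) The map $R\mapsto R-R_1$ is an isomorphism of partially ordered sets from $[R_1,R_2]$ onto $\mathrm{Fa}(R_2-R_1)$. It is $\mathcal W_J$-equivariant: for $\sigma\in\mathcal W_J$ and $R\in[R_1,R_2]$ one has $\sigma R\in[R_1,R_2]$ and $\sigma R-R_1=\sigma(R-R_1)$. It preserves dimension: $\dim(R-R_1)=\dim R$. -/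

import Mathlib

open scoped Pointwise

namespace LinCox

section Cones

variable {E : Type*} [AddCommGroup E] [Module ℝ E]

/-- The difference `K - L = {x - y | x ∈ K, y ∈ L}` of two convex cones with zero. -/
def coneSub (K L : PointedCone ℝ E) : PointedCone ℝ E where
  carrier := (K : Set E) - (L : Set E)
  zero_mem' := ⟨0, K.zero_mem, 0, L.zero_mem, sub_zero 0⟩
  add_mem' := by
    rintro _ _ ⟨a, ha, b, hb, rfl⟩ ⟨c, hc, d, hd, rfl⟩
    exact ⟨a + c, K.add_mem ha hc, b + d, L.add_mem hb hd, add_sub_add_comm a c b d⟩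
  smul_mem' := by
    rintro r _ ⟨a, ha, b, hb, rfl⟩
    exact ⟨r • a, Submodule.smul_mem K r ha, r • b, Submodule.smul_mem L r hb,
      (smul_sub r a b).symm⟩

/-- The nonempty faces of a convex cone with zero. (A nonempty face of such a cone contains zero.)
As a subtype it is ordered by inclusion. -/
def faces (K : PointedCone ℝ E) : Set (PointedCone ℝ E) :=
  {F | F.IsFaceOf K}

/-- The interval of all faces of `K` between `R₁` and `R₂`, ordered by inclusion. -/
def faceInterval (K R₁ R₂ : PointedCone ℝ E) : Set (PointedCone ℝ E) :=
  {R | R ∈ faces K ∧ R₁ ≤ R ∧ R ≤ R₂}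

/-- The dimension of a convex cone: the dimension of its linear hull. -/
noncomputable def coneDim (K : PointedCone ℝ E) : ℕ :=
  Module.finrank ℝ (Submodule.span ℝ (K : Set E))

/-- The relative interior of a subset of a finite dimensional real linear space: its interior
within its affine hull. The module topology is the usual topology of such a space. -/
def relInterior (s : Set E) : Set E :=
  letI : TopologicalSpace E := moduleTopology ℝ E
  intrinsicInterior ℝ s

end Cones

/-- Elements `hᵢ` of `V` and `αᵢ` of the dual of `V` such that `αᵢ(hᵢ) = 2`. They represent the
rays `Hᵢ = ℝ≥0 hᵢ` and `Lᵢ = ℝ≥0 αᵢ` with `Lᵢ \ {0} ⊆ Hᵢ^{>0}`; every such pair of rays arises in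
this way, and the notions below depend only on the rays. -/
structure RayDatum (ι V : Type*) [AddCommGroup V] [Module ℝ V] where
  /-- The element `hᵢ`, spanning the ray `Hᵢ`. -/
  coroot : ι → V
  /-- The element `αᵢ`, spanning the ray `Lᵢ`. -/
  root : ι → Module.Dual ℝ V
  root_coroot : ∀ i, root i (coroot i) = 2

namespace RayDatum

variable {ι V : Type*} [AddCommGroup V] [Module ℝ V] (D : RayDatum ι V)

/-- The reflection `σᵢ`, given by `σᵢ(lam) = lam - lam(hᵢ) αᵢ`. -/
def reflection (i : ι) : Module.Dual ℝ V ≃ₗ[ℝ] Module.Dual ℝ V :=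
  Module.reflection (x := D.root i) (f := Module.Dual.eval ℝ V (D.coroot i)) (D.root_coroot i)

/-- The group generated by the reflections `σᵢ`. -/
def group : Subgroup (Module.Dual ℝ V ≃ₗ[ℝ] Module.Dual ℝ V) :=
  Subgroup.closure (Set.range D.reflection)

/-- The closed chamber, the intersection of the half-spaces `Hᵢ^{≥0}`. -/
def chamber : PointedCone ℝ (Module.Dual ℝ V) where
  carrier := {lam | ∀ i, 0 ≤ lam (D.coroot i)}
  zero_mem' := fun _ => le_rfl
  add_mem' := fun ha hb i => add_nonneg (ha i) (hb i)
  smul_mem' := fun r _ ha i => mul_nonneg r.2 (ha i)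

/-- The open chamber, the intersection of the half-spaces `Hᵢ^{>0}`. -/
def openChamber : Set (Module.Dual ℝ V) :=
  {lam | ∀ i, 0 < lam (D.coroot i)}

/-- The hyperplane `Hᵢ^{=0}`. -/
def hyperplane (i : ι) : Submodule ℝ (Module.Dual ℝ V) :=
  LinearMap.ker (Module.Dual.eval ℝ V (D.coroot i))

/-- The subset `C̄ ∩ Hᵢ^{=0}` of the closed chamber. -/
def wall (i : ι) : PointedCone ℝ (Module.Dual ℝ V) :=
  D.chamber ⊓ PointedCone.ofSubmodule (D.hyperplane i)

/-- The union of the translates of the closed chamber under the group. -/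
def titsCone : Set (Module.Dual ℝ V) :=
  ⋃ σ ∈ D.group, (fun lam => σ lam) '' (D.chamber : Set (Module.Dual ℝ V))

/-- The subfamily indexed by `J ⊆ I`. Its group, chamber and Tits cone are `W_J`, `C̄(J)`, `X(J)`;
for `J = ∅` they are the trivial group, the whole dual of `V`, and the whole dual of `V`. -/
def restrict (J : Set ι) : RayDatum J V where
  coroot := fun j => D.coroot j
  root := fun j => D.root j
  root_coroot := fun j => D.root_coroot j

/-- The family is a linear Coxeter system: the closed chamber spans the dual of `V`, the sets
`C̄ ∩ Hᵢ^{=0}` are its pairwise different faces of codimension one, and the open chamber is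
disjoint from its translates under the nontrivial elements of the group. -/
structure IsLinearCoxeterSystem : Prop where
  span_chamber : Submodule.span ℝ (D.chamber : Set (Module.Dual ℝ V)) = ⊤
  codim_one_faces : ∀ F : PointedCone ℝ (Module.Dual ℝ V),
    (F ∈ faces D.chamber ∧ coneDim F + 1 = Module.finrank ℝ (Module.Dual ℝ V)) ↔
      ∃ i, F = D.wall i
  wall_injective : Function.Injective D.wall
  disjoint_translates : ∀ σ ∈ D.group, σ ≠ 1 →
    Disjoint ((fun lam => σ lam) '' D.openChamber) D.openChamber

/-- The cross section lattice `Υ` of the face lattice of `Y`: the faces of `Y` whose relative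
interior meets the closed chamber. -/
def crossSection (Y : PointedCone ℝ (Module.Dual ℝ V)) : Set (PointedCone ℝ (Module.Dual ℝ V)) :=
  {R | R ∈ faces Y ∧
    (relInterior (R : Set (Module.Dual ℝ V)) ∩ (D.chamber : Set (Module.Dual ℝ V))).Nonempty}

/-- The lower type `υ_*(R)`: the indices `i` such that `σᵢ` fixes `R` pointwise. -/
def lowerType (R : PointedCone ℝ (Module.Dual ℝ V)) : Set ι :=
  {i | ∀ lam ∈ R, D.reflection i lam = lam}

/-- The upper type `υ^*(R)`: the indices `i` such that `σᵢ` fixes `R` as a whole,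
but not pointwise. -/
def upperType (R : PointedCone ℝ (Module.Dual ℝ V)) : Set ι :=
  {i | R.map (D.reflection i).toLinearMap = R} \ D.lowerType R

end RayDatum

end LinCox

/-! The group `W_J` fixes `R₁` pointwise and stabilizes `R₂`, so it acts on `R₂ - R₁`. The Tits cone
lies in `X(J)` (`exists_restrict_nonneg`, an exchange argument on words), and an element of `W_J`
moving `a ∈ R₂` into `C̄(J)` moves `a - b` there too when `b ∈ R₁`, since the `hⱼ` with `j ∈ J`
vanish on `R₁`.

For the intersection with `C̄(J)`, take a relatively interior point `x` of `R₁` in `C̄` that is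
positive on every `hᵢ` with `i ∉ υ_*(R₁)` (`exists_isCorePoint`). If `a - b ∈ C̄(J)`, then `N x + (a
- b)` lies in `R₂ ∩ C̄` for large `N`. The indices in `υ_*(R₁)` need no help from `x`: those in `J`
are covered by assumption, and the others are nonnegative on `R₂` (`nonneg_of_notMem_types`).

The isomorphism of face lattices is pure convexity: every face of `R₂ - R₁` contains the linear
space `R₁ - R₁`, so it is recovered from its intersection with `R₂`. -/

open Filter in
theorem eventually_atTop_pos_mul_add {a : ℝ} (ha : 0 < a) (b : ℝ) :
    ∀ᶠ N : ℝ in atTop, 0 < N * a + b :=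
  ((tendsto_id.atTop_mul_const ha).atTop_add tendsto_const_nhds).eventually_gt_atTop 0

/-! ### Reflections, words and chambers -/

namespace LinCox.RayDatum

variable {ι V : Type*} [AddCommGroup V] [Module ℝ V] {D : RayDatum ι V}

theorem reflection_apply (D : RayDatum ι V) (i : ι) (x : Module.Dual ℝ V) :
    D.reflection i x = x - x (D.coroot i) • D.root i :=
  Module.reflection_apply x (f := Module.Dual.eval ℝ V (D.coroot i)) (D.root_coroot i)

theorem reflection_apply_coroot (D : RayDatum ι V) (i : ι) (x : Module.Dual ℝ V) :
    D.reflection i x (D.coroot i) = -x (D.coroot i) := by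
  rw [reflection_apply, LinearMap.sub_apply, LinearMap.smul_apply, D.root_coroot, smul_eq_mul]
  ring

theorem reflection_apply_eq_self (D : RayDatum ι V) {i : ι} {x : Module.Dual ℝ V}
    (hx : x (D.coroot i) = 0) : D.reflection i x = x := by
  rw [reflection_apply, hx, zero_smul, sub_zero]

theorem apply_coroot_eq_zero {i : ι} {x : Module.Dual ℝ V} (hx : D.reflection i x = x) :
    x (D.coroot i) = 0 := by
  have h := D.reflection_apply_coroot i x
  rw [hx] at h
  linarith

theorem reflection_reflection (D : RayDatum ι V) (i : ι) (x : Module.Dual ℝ V) :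
    D.reflection i (D.reflection i x) = x :=
  Module.involutive_reflection (f := Module.Dual.eval ℝ V (D.coroot i)) (D.root_coroot i) x

theorem reflection_mul_self (D : RayDatum ι V) (i : ι) : D.reflection i * D.reflection i = 1 :=
  LinearEquiv.ext (D.reflection_reflection i)

theorem reflection_ne_one (D : RayDatum ι V) (i : ι) : D.reflection i ≠ 1 := by
  intro h
  have h1 := apply_coroot_eq_zero (D := D) (i := i) (x := D.root i) (by rw [h]; rfl)
  rw [D.root_coroot] at h1
  norm_num at h1

theorem reflection_mem_group (D : RayDatum ι V) (i : ι) : D.reflection i ∈ D.group :=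
  Subgroup.subset_closure ⟨i, rfl⟩

theorem group_induction {p : (Module.Dual ℝ V ≃ₗ[ℝ] Module.Dual ℝ V) → Prop} (one : p 1)
    (refl_mul : ∀ i w, p w → p (D.reflection i * w)) {w} (hw : w ∈ D.group) : p w := by
  refine Subgroup.closure_induction_left (p := fun w _ => p w) one ?_ ?_ hw
  · rintro _ ⟨i, rfl⟩ w _ h
    exact refl_mul i w h
  · rintro _ ⟨i, rfl⟩ w _ h
    rw [inv_eq_of_mul_eq_one_left (D.reflection_mul_self i)]
    exact refl_mul i w h

theorem group_restrict_le (D : RayDatum ι V) (J : Set ι) : (D.restrict J).group ≤ D.group := by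
  refine (Subgroup.closure_le _).2 ?_
  rintro _ ⟨j, rfl⟩
  exact D.reflection_mem_group j

theorem exists_list_prod_eq {w : Module.Dual ℝ V ≃ₗ[ℝ] Module.Dual ℝ V} (hw : w ∈ D.group) :
    ∃ l : List ι, (l.map D.reflection).prod = w := by
  refine group_induction (p := fun w => ∃ l : List ι, (l.map D.reflection).prod = w)
    ⟨[], rfl⟩ ?_ hw
  rintro i w ⟨l, rfl⟩
  exact ⟨i :: l, by simp⟩

theorem list_prod_mem_group (D : RayDatum ι V) (l : List ι) :
    (l.map D.reflection).prod ∈ D.group := by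
  refine Subgroup.list_prod_mem _ fun x hx => ?_
  obtain ⟨i, _, rfl⟩ := List.mem_map.1 hx
  exact D.reflection_mem_group i

theorem add_smul_mem_openChamber {x c : Module.Dual ℝ V} (hx : x ∈ D.chamber)
    (hc : c ∈ D.openChamber) {t : ℝ} (ht : 0 < t) : x + t • c ∈ D.openChamber :=
  fun i => add_pos_of_nonneg_of_pos (hx i) (mul_pos ht (hc i))

/-- A linear form that is nonnegative on the open chamber is nonnegative on the closed chamber. -/
theorem nonneg_of_nonneg_openChamber (hne : D.openChamber.Nonempty)
    (f : Module.Dual ℝ V →ₗ[ℝ] ℝ) (hf : ∀ x ∈ D.openChamber, 0 ≤ f x) {x : Module.Dual ℝ V}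
    (hx : x ∈ D.chamber) : 0 ≤ f x := by
  obtain ⟨c, hc⟩ := hne
  by_contra! h
  have h1 := hf c hc
  have h2 := hf _ (add_smul_mem_openChamber hx hc
    -- Chosen so that `t * f c ≤ -f x / 2`; the `+ 1` keeps the denominator positive when `f c = 0`.
    (t := -f x / (2 * (f c + 1))) (by apply div_pos <;> linarith))
  rw [map_add, map_smul, smul_eq_mul] at h2
  have h3 : -f x / (2 * (f c + 1)) * f c ≤ -f x / 2 := by
    rw [div_mul_eq_mul_div, div_le_div_iff₀ (by linarith) (by norm_num)]
    nlinarith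
  linarith

/-- The linear form `x ↦ (w x)(hᵢ)`. -/
def evalCoroot (D : RayDatum ι V) (w : Module.Dual ℝ V ≃ₗ[ℝ] Module.Dual ℝ V) (i : ι) :
    Module.Dual ℝ V →ₗ[ℝ] ℝ :=
  Module.Dual.eval ℝ V (D.coroot i) ∘ₗ w.toLinearMap

@[simp] theorem evalCoroot_apply (w : Module.Dual ℝ V ≃ₗ[ℝ] Module.Dual ℝ V) (i : ι)
    (x : Module.Dual ℝ V) : D.evalCoroot w i x = w x (D.coroot i) := rfl

/-- For finitely many indices, a sum of elements of the chamber realizes all their strict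
inequalities at once. -/
theorem exists_mem_chamber_pos [Finite ι] (K : PointedCone ℝ (Module.Dual ℝ V)) (hK : K ≤ D.chamber)
    (P : Set ι) (h : ∀ i ∈ P, ∃ x ∈ K, 0 < x (D.coroot i)) :
    ∃ x ∈ K, ∀ i ∈ P, 0 < x (D.coroot i) := by
  have := Fintype.ofFinite ι
  have h' : ∀ i, ∃ x ∈ K, i ∈ P → 0 < x (D.coroot i) := fun i => by
    by_cases hi : i ∈ P
    · obtain ⟨x, hx, hx'⟩ := h i hi
      exact ⟨x, hx, fun _ => hx'⟩
    · exact ⟨0, K.zero_mem, fun h => absurd h hi⟩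
  choose f hf hf' using h'
  refine ⟨∑ j, f j, sum_mem fun j _ => hf j, fun i hi => ?_⟩
  rw [LinearMap.sum_apply]
  exact Finset.sum_pos' (fun j _ => hK (hf j) i) ⟨i, Finset.mem_univ i, hf' i hi⟩

/-! ### Linear Coxeter systems: exchange, and the Tits cone inside `X(J)` -/

namespace IsLinearCoxeterSystem

theorem openChamber_nonempty [Finite ι] (hD : D.IsLinearCoxeterSystem) : D.openChamber.Nonempty := by
  obtain ⟨x, _, hx⟩ := exists_mem_chamber_pos D.chamber le_rfl Set.univ fun i _ => by
    by_contra! h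
    have h1 : Submodule.span ℝ (D.chamber : Set (Module.Dual ℝ V)) ≤ D.hyperplane i :=
      Submodule.span_le.2 fun x hx => le_antisymm (h x hx) (hx i)
    rw [hD.span_chamber] at h1
    have h2 : D.root i (D.coroot i) = 0 := h1 (Submodule.mem_top (x := D.root i))
    rw [D.root_coroot] at h2
    norm_num at h2
  exact ⟨x, fun i => hx i (Set.mem_univ i)⟩

theorem span_wall [FiniteDimensional ℝ V] (hD : D.IsLinearCoxeterSystem) (i : ι) :
    Submodule.span ℝ (D.wall i : Set (Module.Dual ℝ V)) = D.hyperplane i := by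
  have h1 := ((hD.codim_one_faces (D.wall i)).2 ⟨i, rfl⟩).2
  unfold coneDim at h1
  have hle : Submodule.span ℝ (D.wall i : Set (Module.Dual ℝ V)) ≤ D.hyperplane i :=
    Submodule.span_le.2 fun x hx => hx.2
  refine Submodule.eq_of_le_of_finrank_le hle ?_
  have h2 : D.hyperplane i < ⊤ := by
    refine lt_top_iff_ne_top.2 fun h => ?_
    have h3 : D.root i (D.coroot i) = 0 := h.ge (Submodule.mem_top (x := D.root i))
    rw [D.root_coroot] at h3
    norm_num at h3
  have := Submodule.finrank_lt h2.ne
  omega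

theorem exists_mem_wall [Finite ι] [FiniteDimensional ℝ V] (hD : D.IsLinearCoxeterSystem) (i : ι) :
    ∃ x ∈ D.wall i, ∀ j, j ≠ i → 0 < x (D.coroot j) := by
  refine exists_mem_chamber_pos (D.wall i) inf_le_left {j | j ≠ i} fun j hj => ?_
  by_contra! h
  have hle : D.wall i ≤ D.wall j := fun x hx => ⟨hx.1, le_antisymm (h x hx) (hx.1 j)⟩
  refine hj (hD.wall_injective (le_antisymm (fun x hx => ⟨hx.1, ?_⟩) hle))
  have h1 : D.hyperplane i ≤ D.hyperplane j := by
    rw [← hD.span_wall, ← hD.span_wall]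
    exact Submodule.span_mono hle
  have h2 : D.hyperplane i = D.hyperplane j := by
    refine Submodule.eq_of_le_of_finrank_eq h1 ?_
    have a := ((hD.codim_one_faces (D.wall i)).2 ⟨i, rfl⟩).2
    have b := ((hD.codim_one_faces (D.wall j)).2 ⟨j, rfl⟩).2
    unfold coneDim at a b
    rw [hD.span_wall] at a b
    omega
  exact h2.ge hx.2

theorem eq_one_of_mem_openChamber (hD : D.IsLinearCoxeterSystem)
    {w : Module.Dual ℝ V ≃ₗ[ℝ] Module.Dual ℝ V} (hw : w ∈ D.group) {x : Module.Dual ℝ V}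
    (hx : x ∈ D.openChamber) (hwx : w x ∈ D.openChamber) : w = 1 := by
  by_contra h
  exact Set.disjoint_left.1 (hD.disjoint_translates w hw h) ⟨x, hx, rfl⟩ hwx

/-- Otherwise the conjugate `w⁻¹ σᵢ w` would fix a point of the open chamber, hence be trivial. -/
theorem apply_coroot_ne_zero (hD : D.IsLinearCoxeterSystem)
    {w : Module.Dual ℝ V ≃ₗ[ℝ] Module.Dual ℝ V} (hw : w ∈ D.group) {x : Module.Dual ℝ V}
    (hx : x ∈ D.openChamber) (i : ι) : w x (D.coroot i) ≠ 0 := by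
  intro h
  have h1 : w⁻¹ * D.reflection i * w = 1 := by
    refine hD.eq_one_of_mem_openChamber
      (mul_mem (mul_mem (inv_mem hw) (D.reflection_mem_group i)) hw) hx ?_
    have : (w⁻¹ * D.reflection i * w) x = x := by
      simp only [LinearEquiv.mul_apply, D.reflection_apply_eq_self h]
      exact w.symm_apply_apply x
    rwa [this]
  refine D.reflection_ne_one i ?_
  rw [mul_assoc, inv_mul_eq_one] at h1
  exact mul_eq_right.1 h1.symm

/-- A translate of the open chamber lies strictly on one side of each of the hyperplanes. -/
theorem pos_or_neg (hD : D.IsLinearCoxeterSystem)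
    {w : Module.Dual ℝ V ≃ₗ[ℝ] Module.Dual ℝ V} (hw : w ∈ D.group) (i : ι) :
    (∀ x ∈ D.openChamber, 0 < w x (D.coroot i)) ∨ ∀ x ∈ D.openChamber, w x (D.coroot i) < 0 := by
  by_contra! h
  obtain ⟨⟨x, hx, hx'⟩, y, hy, hy'⟩ := h
  replace hx' := hx'.lt_of_ne (hD.apply_coroot_ne_zero hw hx i)
  replace hy' := hy'.lt_of_ne' (hD.apply_coroot_ne_zero hw hy i)
  set a := w x (D.coroot i) with ha
  set b := w y (D.coroot i) with hb
  -- With values `a < 0 < b` at `x` and `y`, this positive combination stays in the open chamber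
  -- while the form vanishes on it.
  refine hD.apply_coroot_ne_zero hw (x := b • x + (-a) • y) (fun j => ?_) i ?_
  · exact add_pos (mul_pos hy' (hx j)) (mul_pos (neg_pos.2 hx') (hy j))
  · rw [map_add, map_smul, map_smul, LinearMap.add_apply, LinearMap.smul_apply,
      LinearMap.smul_apply, ← ha, ← hb, smul_eq_mul, smul_eq_mul]
    ring

open Filter in
/-- If the hyperplane of `i` separates the adjacent chambers `u C` and `u σₖ C`, then
`σᵢ u = u σₖ`. -/
theorem reflection_mul_eq_mul_reflection [Finite ι] [FiniteDimensional ℝ V]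
    (hD : D.IsLinearCoxeterSystem)
    {u : Module.Dual ℝ V ≃ₗ[ℝ] Module.Dual ℝ V} (hu : u ∈ D.group) {i k : ι}
    (hpos : ∀ x ∈ D.openChamber, 0 < u x (D.coroot i))
    (hneg : ∀ x ∈ D.openChamber, u (D.reflection k x) (D.coroot i) < 0) :
    D.reflection i * u = u * D.reflection k := by
  have hne := hD.openChamber_nonempty
  -- On the wall of `k`, which `σₖ` fixes, the form is both nonnegative and nonpositive, and the
  -- wall spans the hyperplane.
  have hvan : D.hyperplane k ≤ LinearMap.ker (D.evalCoroot u i) := by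
    rw [← hD.span_wall, Submodule.span_le]
    intro x hx
    have h1 := nonneg_of_nonneg_openChamber hne (D.evalCoroot u i)
      (fun y hy => (hpos y hy).le) hx.1
    have h2 := nonneg_of_nonneg_openChamber hne (-D.evalCoroot (u * D.reflection k) i)
      (fun y hy => (neg_pos.2 (hneg y hy)).le) hx.1
    simp only [LinearMap.neg_apply, evalCoroot_apply, LinearEquiv.mul_apply] at h1 h2
    rw [D.reflection_apply_eq_self (x := x) hx.2] at h2
    exact le_antisymm (neg_nonneg.1 h2) h1
  have hprop : ∀ x : Module.Dual ℝ V,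
      2 * u x (D.coroot i) = x (D.coroot k) * u (D.root k) (D.coroot i) := by
    intro x
    have h : (2 : ℝ) • x - x (D.coroot k) • D.root k ∈ D.hyperplane k := by
      change ((2 : ℝ) • x - x (D.coroot k) • D.root k) (D.coroot k) = 0
      rw [LinearMap.sub_apply, LinearMap.smul_apply, LinearMap.smul_apply, D.root_coroot,
        smul_eq_mul, smul_eq_mul]
      ring
    have h' : u ((2 : ℝ) • x - x (D.coroot k) • D.root k) (D.coroot i) = 0 := hvan h
    rw [map_sub, map_smul, map_smul, LinearMap.sub_apply, LinearMap.smul_apply,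
      LinearMap.smul_apply, smul_eq_mul, smul_eq_mul] at h'
    linarith
  obtain ⟨c, hc⟩ := hne
  have hroot : 0 < u (D.root k) (D.coroot i) := by
    have h1 := hprop c
    have h2 := hpos c hc
    have h3 := hc k
    by_contra! h4
    nlinarith
  obtain ⟨x, hx, hx'⟩ := hD.exists_mem_wall k
  -- A product of two reflections in the same hyperplane. It fixes `x`, which lies on the wall of
  -- `k` only, and keeps `c` on the positive side of it, so it sends `N x + c` into the open chamber
  -- for large `N` and must be trivial.
  set τ := D.reflection k * (u⁻¹ * D.reflection i * u) with hτ
  have hτmem : τ ∈ D.group := mul_mem (D.reflection_mem_group k)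
    (mul_mem (mul_mem (inv_mem hu) (D.reflection_mem_group i)) hu)
  have hux : u x (D.coroot i) = 0 := hvan hx.2
  have hτx : τ x = x := by
    simp only [hτ, LinearEquiv.mul_apply, D.reflection_apply_eq_self hux]
    rw [show u⁻¹ (u x) = x from u.symm_apply_apply x, D.reflection_apply_eq_self (x := x) hx.2]
  have hτc : 0 < τ c (D.coroot k) := by
    simp only [hτ, LinearEquiv.mul_apply, D.reflection_apply_coroot]
    have h1 := hprop (u⁻¹ (D.reflection i (u c)))
    rw [show u (u⁻¹ (D.reflection i (u c))) = _ from u.apply_symm_apply _,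
      D.reflection_apply_coroot] at h1
    have h2 := hpos c hc
    by_contra! h3
    nlinarith
  have hev : ∀ᶠ N : ℝ in atTop, ∀ j, 0 < τ (N • x + c) (D.coroot j) := by
    refine eventually_all.2 fun j => ?_
    simp only [map_add, map_smul, hτx, LinearMap.add_apply, LinearMap.smul_apply, smul_eq_mul]
    by_cases hj : j = k
    · subst hj
      rw [show x (D.coroot j) = 0 from hx.2]
      simpa only [mul_zero, zero_add] using Eventually.of_forall fun _ => hτc
    · exact eventually_atTop_pos_mul_add (hx' j hj) _
  obtain ⟨N, hN, hN0⟩ := (hev.and (eventually_ge_atTop 0)).exists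
  have hone : τ = 1 := hD.eq_one_of_mem_openChamber hτmem
    (x := N • x + c) (fun j => add_pos_of_nonneg_of_pos (mul_nonneg hN0 (hx.1 j)) (hc j)) hN
  have h1 := eq_inv_of_mul_eq_one_right hone
  rw [inv_eq_of_mul_eq_one_left (D.reflection_mul_self k), mul_assoc,
    inv_mul_eq_iff_eq_mul] at h1
  exact h1

/-- Drop the last letter `k`. If the remaining word `u` puts the chamber on the positive side, the
hyperplane of `i` separates `u C` from `u σₖ C`, and `σᵢ` cancels the letter; otherwise recurse on
`u`. -/
theorem exists_shorter [Finite ι] [FiniteDimensional ℝ V] (hD : D.IsLinearCoxeterSystem)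
    (i : ι) (l : List ι)
    (hneg : ∀ x ∈ D.openChamber, (l.map D.reflection).prod x (D.coroot i) < 0) :
    ∃ l' : List ι, l'.length < l.length ∧
      (l'.map D.reflection).prod = D.reflection i * (l.map D.reflection).prod := by
  induction l using List.reverseRecOn with
  | nil =>
    obtain ⟨c, hc⟩ := hD.openChamber_nonempty
    exact absurd (hneg c hc) (hc i).not_gt
  | append_singleton l k ih =>
    simp only [List.map_append, List.prod_append, List.map_cons, List.map_nil,
      List.prod_singleton, List.length_append, List.length_singleton] at hneg ⊢
    rcases hD.pos_or_neg (D.list_prod_mem_group l) i with h | h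
    · refine ⟨l, Nat.lt_succ_self _, ?_⟩
      rw [← mul_assoc, hD.reflection_mul_eq_mul_reflection (D.list_prod_mem_group l) h hneg,
        mul_assoc, D.reflection_mul_self, mul_one]
    · obtain ⟨l', hl', h'⟩ := ih h
      refine ⟨l' ++ [k], by simpa using hl', ?_⟩
      simp [h', mul_assoc]

/-- While some `j ∈ J` is negative on the translated chamber, multiplying by `σⱼ` shortens the word,
so the process ends. -/
theorem exists_mul_pos [Finite ι] [FiniteDimensional ℝ V] (hD : D.IsLinearCoxeterSystem) (J : Set ι) :
    ∀ l : List ι, ∃ v ∈ (D.restrict J).group, ∀ j ∈ J, ∀ x ∈ D.openChamber,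
      0 < v ((l.map D.reflection).prod x) (D.coroot j) := by
  suffices h : ∀ (n : ℕ) (l : List ι), l.length < n → ∃ v ∈ (D.restrict J).group, ∀ j ∈ J,
      ∀ x ∈ D.openChamber, 0 < v ((l.map D.reflection).prod x) (D.coroot j) from
    fun l => h _ l (Nat.lt_succ_self _)
  intro n
  induction n with
  | zero => exact fun l hl => absurd hl (Nat.not_lt_zero _)
  | succ n ih =>
    intro l hl
    by_cases h : ∀ j ∈ J, ∀ x ∈ D.openChamber, 0 < (l.map D.reflection).prod x (D.coroot j)
    · exact ⟨1, one_mem _, h⟩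
    · push Not at h
      obtain ⟨j, hj, x, hx, hx'⟩ := h
      obtain ⟨l', hl', h'⟩ := hD.exists_shorter j l
        ((hD.pos_or_neg (D.list_prod_mem_group l) j).resolve_left fun h => (h x hx).not_ge hx')
      obtain ⟨v, hv, hv'⟩ := ih l' (by omega)
      refine ⟨v * D.reflection j,
        mul_mem hv ((D.restrict J).reflection_mem_group ⟨j, hj⟩), ?_⟩
      rwa [h'] at hv'

/-- The Tits cone is contained in the Tits cone of every subfamily. -/
theorem exists_restrict_nonneg [Finite ι] [FiniteDimensional ℝ V]
    (hD : D.IsLinearCoxeterSystem) (J : Set ι) {x : Module.Dual ℝ V}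
    (hx : x ∈ D.titsCone) :
    ∃ v ∈ (D.restrict J).group, ∀ j ∈ J, 0 ≤ v x (D.coroot j) := by
  simp only [titsCone, Set.mem_iUnion] at hx
  obtain ⟨w, hw, y, hy, rfl⟩ := hx
  obtain ⟨l, rfl⟩ := exists_list_prod_eq hw
  obtain ⟨v, hv, h⟩ := hD.exists_mul_pos J l
  refine ⟨v, hv, fun j hj => ?_⟩
  exact nonneg_of_nonneg_openChamber hD.openChamber_nonempty
    (D.evalCoroot (v * (l.map D.reflection).prod) j) (fun z hz => (h j hj z hz).le) hy

end IsLinearCoxeterSystem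

end LinCox.RayDatum

/-! ### Faces of a difference of cones -/

namespace LinCox

section Cones

variable {E : Type*} [AddCommGroup E] [Module ℝ E]

theorem sub_mem_coneSub {K L : PointedCone ℝ E} {a b : E} (ha : a ∈ K) (hb : b ∈ L) :
    a - b ∈ coneSub K L := ⟨a, ha, b, hb, rfl⟩

theorem le_coneSub (K L : PointedCone ℝ E) : K ≤ coneSub K L :=
  fun a ha => ⟨a, ha, 0, L.zero_mem, sub_zero a⟩

theorem coneSub_mono_left {K K' : PointedCone ℝ E} (h : K ≤ K') (L : PointedCone ℝ E) :
    coneSub K L ≤ coneSub K' L := by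
  rintro _ ⟨a, ha, b, hb, rfl⟩
  exact sub_mem_coneSub (h ha) hb

theorem map_coneSub (f : E →ₗ[ℝ] E) (K L : PointedCone ℝ E) :
    (coneSub K L).map f = coneSub (K.map f) (L.map f) := by
  ext x
  constructor
  · rintro ⟨_, ⟨a, ha, b, hb, rfl⟩, rfl⟩
    exact ⟨f a, ⟨a, ha, rfl⟩, f b, ⟨b, hb, rfl⟩, (map_sub f a b).symm⟩
  · rintro ⟨_, ⟨a, ha, rfl⟩, _, ⟨b, hb, rfl⟩, rfl⟩
    exact ⟨a - b, sub_mem_coneSub ha hb, map_sub f a b⟩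

theorem coneDim_coneSub {K L : PointedCone ℝ E} (h : L ≤ K) :
    coneDim (coneSub K L) = coneDim K := by
  unfold coneDim
  rw [le_antisymm (Submodule.span_le.2 ?_) (Submodule.span_mono (le_coneSub K L))]
  rintro _ ⟨a, ha, b, hb, rfl⟩
  exact sub_mem (Submodule.subset_span ha) (Submodule.subset_span (h hb))

theorem isFaceOf_coneSub {R R₁ R₂ : PointedCone ℝ E} (hR : R.IsFaceOf R₂) (h : R₁ ≤ R) :
    (coneSub R R₁).IsFaceOf (coneSub R₂ R₁) where
  le := coneSub_mono_left hR.le R₁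
  mem_of_smul_add_mem := by
    rintro _ _ t ⟨a, ha, b, hb, rfl⟩ ⟨c, hc, d, hd, rfl⟩ ht ⟨r, hr, s, hs, h'⟩
    refine sub_mem_coneSub (hR.mem_of_smul_add_mem ha (R₂.add_mem hc (hR.le (h hs))) ht ?_) hb
    have h1 : t • a + (c + s) = r + (t • b + d) := by
      have h2 : r - s = t • (a - b) + (c - d) := h'
      rw [smul_sub] at h2
      rw [sub_eq_iff_eq_add] at h2
      rw [h2]
      abel
    rw [h1]
    exact R.add_mem hr (R.add_mem (R.smul_mem ht.le (h hb)) (h hd))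

/-- Both `a - b` and `b - a` lie in the cone and sum to `0`, so the face contains each of them. -/
theorem sub_mem_of_isFaceOf_coneSub {F R₁ R₂ : PointedCone ℝ E} (h : R₁ ≤ R₂)
    (hF : F.IsFaceOf (coneSub R₂ R₁)) {a b : E} (ha : a ∈ R₁) (hb : b ∈ R₁) : a - b ∈ F := by
  refine hF.mem_of_add_mem_left (sub_mem_coneSub (h ha) hb) (sub_mem_coneSub (h hb) ha) ?_
  rw [sub_add_sub_cancel, sub_self]
  exact F.zero_mem

theorem coneSub_inf_of_isFaceOf {R R₁ R₂ : PointedCone ℝ E} (hR : R.IsFaceOf R₂) (h : R₁ ≤ R) :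
    coneSub R R₁ ⊓ R₂ = R := by
  refine le_antisymm ?_ (le_inf (le_coneSub R R₁) hR.le)
  rintro _ ⟨⟨r, hr, s, hs, rfl⟩, h2⟩
  refine hR.mem_of_add_mem_left h2 (hR.le (h hs)) ?_
  change r - s + s ∈ R
  rwa [sub_add_cancel]

theorem coneSub_inf_eq_of_isFaceOf {F R₁ R₂ : PointedCone ℝ E} (h : R₁ ≤ R₂)
    (hF : F.IsFaceOf (coneSub R₂ R₁)) : coneSub (F ⊓ R₂) R₁ = F := by
  apply le_antisymm
  · rintro _ ⟨a, ha, b, hb, rfl⟩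
    have h1 := F.add_mem ha.1 (sub_mem_of_isFaceOf_coneSub h hF R₁.zero_mem hb)
    rwa [zero_sub, ← sub_eq_add_neg] at h1
  · intro x hx
    obtain ⟨a, ha, b, hb, rfl⟩ := hF.le hx
    refine sub_mem_coneSub ⟨?_, ha⟩ hb
    have h1 := F.add_mem hx (sub_mem_of_isFaceOf_coneSub h hF hb R₁.zero_mem)
    change a - b + (b - 0) ∈ F at h1
    rwa [sub_zero, sub_add_cancel] at h1

theorem isFaceOf_of_mem_faceInterval {Y R₁ R₂ : PointedCone ℝ E} (hR₂ : R₂ ∈ faces Y)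
    (R : faceInterval Y R₁ R₂) : (R : PointedCone ℝ E).IsFaceOf R₂ :=
  (PointedCone.IsFaceOf.isFaceOf_iff_le R.2.1 hR₂).2 R.2.2.2

theorem inf_mem_faceInterval {Y R₁ R₂ F : PointedCone ℝ E} (hR₂ : R₂ ∈ faces Y) (h : R₁ ≤ R₂)
    (hF : F.IsFaceOf (coneSub R₂ R₁)) : F ⊓ R₂ ∈ faceInterval Y R₁ R₂ := by
  refine ⟨?_, fun b hb => ⟨?_, h hb⟩, inf_le_right⟩
  · have h1 : (F ⊓ R₂).IsFaceOf R₂ := by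
      have := hF.inf (PointedCone.IsFaceOf.refl R₂)
      rwa [inf_eq_right.2 (le_coneSub R₂ R₁)] at this
    exact h1.trans hR₂
  · have h1 := sub_mem_of_isFaceOf_coneSub h hF hb R₁.zero_mem
    rwa [sub_zero] at h1

/-- Subtracting a face `R₁` identifies the faces between `R₁` and `R₂` with those of `R₂ - R₁`. -/
def faceIntervalEquiv {Y R₁ R₂ : PointedCone ℝ E} (hR₂ : R₂ ∈ faces Y) (h : R₁ ≤ R₂) :
    faceInterval Y R₁ R₂ ≃o faces (coneSub R₂ R₁) where
  toFun R := ⟨coneSub R R₁, isFaceOf_coneSub (isFaceOf_of_mem_faceInterval hR₂ R) R.2.2.1⟩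
  invFun F := ⟨F ⊓ R₂, inf_mem_faceInterval hR₂ h F.2⟩
  left_inv R := Subtype.ext
    (coneSub_inf_of_isFaceOf (isFaceOf_of_mem_faceInterval hR₂ R) R.2.2.1)
  right_inv F := Subtype.ext (coneSub_inf_eq_of_isFaceOf h F.2)
  map_rel_iff' {R S} := by
    refine ⟨fun hle => ?_, fun hle => coneSub_mono_left hle R₁⟩
    have h1 := inf_le_inf_right R₂ (show coneSub (R : PointedCone ℝ E) R₁ ≤ coneSub S R₁ from hle)
    rwa [coneSub_inf_of_isFaceOf (isFaceOf_of_mem_faceInterval hR₂ R) R.2.2.1,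
      coneSub_inf_of_isFaceOf (isFaceOf_of_mem_faceInterval hR₂ S) S.2.2.1] at h1

/-! ### Relative interior points -/

open Filter in
/-- The algebraic description of the points of the relative interior of a convex cone. -/
def IsCorePoint (R : PointedCone ℝ E) (x : E) : Prop :=
  x ∈ R ∧ ∀ b ∈ R, ∀ᶠ N : ℝ in atTop, N • x - b ∈ R

theorem IsCorePoint.of_exists {R : PointedCone ℝ E} {x : E} (hx : x ∈ R)
    (h : ∀ b ∈ R, ∃ N : ℝ, N • x - b ∈ R) : IsCorePoint R x := by
  refine ⟨hx, fun b hb => ?_⟩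
  obtain ⟨N, hN⟩ := h b hb
  filter_upwards [Filter.eventually_ge_atTop N] with M hM
  have h1 := R.add_mem hN (R.smul_mem (sub_nonneg.2 hM) hx)
  rwa [sub_smul, add_comm, sub_add_sub_cancel] at h1

theorem IsCorePoint.smul_add {R : PointedCone ℝ E} {x y : E} (hx : IsCorePoint R x) (hy : y ∈ R)
    {N : ℝ} (hN : 0 < N) : IsCorePoint R (N • x + y) := by
  refine .of_exists (R.add_mem (R.smul_mem hN.le hx.1) hy) fun b hb => ?_
  obtain ⟨M, hM, hM0⟩ := ((hx.2 b hb).and (Filter.eventually_ge_atTop 0)).exists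
  refine ⟨M / N, ?_⟩
  rw [_root_.smul_add, smul_smul, div_mul_cancel₀ M hN.ne', add_sub_right_comm]
  exact R.add_mem hM (R.smul_mem (div_nonneg hM0 hN.le) hy)

open Filter Topology in
theorem isCorePoint_of_mem_relInterior {R : PointedCone ℝ E} {x : E}
    (hx : x ∈ relInterior (R : Set E)) : IsCorePoint R x := by
  let _ : TopologicalSpace E := moduleTopology ℝ E
  have : IsModuleTopology ℝ E := ⟨rfl⟩
  have : IsTopologicalAddGroup E := IsModuleTopology.topologicalAddGroup ℝ E
  obtain ⟨y, hy, rfl⟩ := mem_intrinsicInterior.1 (show x ∈ intrinsicInterior ℝ (R : Set E) from hx)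
  have hint := interior_subset (s := ((↑) ⁻¹' (R : Set E) : Set (affineSpan ℝ (R : Set E))))
  have hyR : (y : E) ∈ R := hint hy
  refine .of_exists hyR fun b hb => ?_
  have hmem : ∀ t : ℝ, AffineMap.lineMap (y : E) b (-t) ∈ affineSpan ℝ (R : Set E) := fun t =>
    AffineMap.lineMap_mem _ y.2 (subset_affineSpan ℝ _ hb)
  let γ : ℝ → affineSpan ℝ (R : Set E) := fun t => ⟨AffineMap.lineMap (y : E) b (-t), hmem t⟩
  have hγ : Continuous γ := by
    refine Continuous.subtype_mk ?_ _
    simp only [AffineMap.lineMap_apply_module']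
    fun_prop
  have hγ0 : γ 0 = y := Subtype.ext (by simp [γ])
  have h1 : ∀ᶠ t in 𝓝 (0 : ℝ), γ t ∈ interior ((↑) ⁻¹' (R : Set E) : Set (affineSpan ℝ _)) :=
    hγ.continuousAt.eventually_mem (by rw [hγ0]; exact isOpen_interior.mem_nhds hy)
  obtain ⟨t, ht, ht0⟩ := ((h1.filter_mono nhdsWithin_le_nhds).and
    (self_mem_nhdsWithin (a := (0 : ℝ)) (s := Set.Ioi 0))).exists
  replace ht0 : 0 < t := ht0
  -- This point is `(1 + t) y - t b`, slightly beyond `y` as seen from `b`; dividing by `t` gives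
  -- the required form.
  have h2 : AffineMap.lineMap (y : E) b (-t) ∈ R := hint ht
  refine ⟨t⁻¹ * (1 + t), ?_⟩
  have h3 := R.smul_mem (inv_nonneg.2 ht0.le) h2
  rw [AffineMap.lineMap_apply_module, sub_neg_eq_add, _root_.smul_add, smul_smul, smul_smul,
    mul_neg, inv_mul_cancel₀ ht0.ne', neg_smul, one_smul, ← sub_eq_add_neg] at h3
  exact h3

/-- A face of a cone that contains a relatively interior point of a subcone contains the
subcone. -/
theorem IsCorePoint.le_of_mem {Y R F : PointedCone ℝ E} {x : E} (hx : IsCorePoint R x)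
    (hR : R ≤ Y) (hF : F.IsFaceOf Y) (hxF : x ∈ F) : R ≤ F := by
  intro b hb
  obtain ⟨N, hN, hN0⟩ := ((hx.2 b hb).and (Filter.eventually_ge_atTop 0)).exists
  refine hF.mem_of_add_mem_left (hR hb) (hR hN) ?_
  rw [add_sub_cancel]
  exact F.smul_mem hN0 hxF

end Cones

/-! ### The cross section and the types of its faces -/

namespace RayDatum

variable {ι V : Type*} [AddCommGroup V] [Module ℝ V] {D : RayDatum ι V}

theorem map_eq_of_mem_restrict_group {J : Set ι} {R : PointedCone ℝ (Module.Dual ℝ V)}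
    (h : ∀ j ∈ J, R.map (D.reflection j).toLinearMap = R)
    {σ : Module.Dual ℝ V ≃ₗ[ℝ] Module.Dual ℝ V} (hσ : σ ∈ (D.restrict J).group) :
    R.map σ.toLinearMap = R := by
  refine group_induction (p := fun w => R.map w.toLinearMap = R) R.map_id (fun j w hw => ?_) hσ
  have h1 := h j j.2
  nth_rewrite 1 [← hw] at h1
  rwa [PointedCone.map_map] at h1

theorem apply_eq_of_mem_restrict_group {J : Set ι} {x : Module.Dual ℝ V}
    (h : ∀ j ∈ J, x (D.coroot j) = 0)
    {σ : Module.Dual ℝ V ≃ₗ[ℝ] Module.Dual ℝ V} (hσ : σ ∈ (D.restrict J).group) : σ x = x := by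
  refine group_induction (p := fun w => w x = x) rfl (fun j w hw => ?_) hσ
  rw [LinearEquiv.mul_apply, hw]
  exact (D.restrict J).reflection_apply_eq_self (h j j.2)

theorem map_eq_of_forall_apply_eq {R : PointedCone ℝ (Module.Dual ℝ V)}
    {σ : Module.Dual ℝ V ≃ₗ[ℝ] Module.Dual ℝ V} (h : ∀ x ∈ R, σ x = x) :
    R.map σ.toLinearMap = R := by
  ext x
  constructor
  · rintro ⟨y, hy, rfl⟩
    change σ y ∈ R
    rwa [h y hy]
  · exact fun hx => ⟨x, hx, h x hx⟩

theorem apply_coroot_eq_zero_of_mem_lowerType {R : PointedCone ℝ (Module.Dual ℝ V)} {i : ι}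
    (hi : i ∈ D.lowerType R) {x : Module.Dual ℝ V} (hx : x ∈ R) : x (D.coroot i) = 0 :=
  apply_coroot_eq_zero (hi x hx)

/-- A reflection fixing a relatively interior point of a face of an invariant cone stabilizes
the face. -/
theorem map_reflection_eq {Y R : PointedCone ℝ (Module.Dual ℝ V)}
    (hYW : ∀ σ ∈ D.group, Y.map σ.toLinearMap = Y) (hR : R ∈ faces Y) {x : Module.Dual ℝ V}
    (hx : IsCorePoint R x) {i : ι} (hi : x (D.coroot i) = 0) :
    R.map (D.reflection i).toLinearMap = R := by
  have hface : (R.map (D.reflection i).toLinearMap).IsFaceOf Y := by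
    have h := PointedCone.IsFaceOf.map_equiv (D.reflection i) hR
    rwa [show PointedCone.map _ Y = Y from hYW _ (D.reflection_mem_group i)] at h
  have hle : R ≤ R.map (D.reflection i).toLinearMap :=
    hx.le_of_mem hR.le hface ⟨x, hx.1, D.reflection_apply_eq_self hi⟩
  refine le_antisymm ?_ hle
  rintro _ ⟨y, hy, rfl⟩
  obtain ⟨z, hz, rfl⟩ := hle hy
  change D.reflection i (D.reflection i z) ∈ R
  rwa [D.reflection_reflection]

variable [Finite ι] [FiniteDimensional ℝ V]

/-- A face in the cross section has a relatively interior point in the closed chamber that lies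
only on the hyperplanes containing the face. -/
theorem exists_isCorePoint (hD : D.IsLinearCoxeterSystem)
    {Y : PointedCone ℝ (Module.Dual ℝ V)} (hYX : (Y : Set (Module.Dual ℝ V)) ⊆ D.titsCone)
    (hYW : ∀ σ ∈ D.group, Y.map σ.toLinearMap = Y) {R : PointedCone ℝ (Module.Dual ℝ V)}
    (hR : R ∈ D.crossSection Y) :
    ∃ x, IsCorePoint R x ∧ x ∈ D.chamber ∧ ∀ i, i ∉ D.lowerType R → 0 < x (D.coroot i) := by
  obtain ⟨hface, x₀, hx₀, hx₀C⟩ := hR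
  -- Adding `z` to `x₀` makes every `hᵢ` positive that is positive somewhere on `R ∩ C̄`.
  obtain ⟨z, hz, hz'⟩ := exists_mem_chamber_pos (R ⊓ D.chamber) inf_le_right
    {i | ∃ x ∈ R ⊓ D.chamber, 0 < x (D.coroot i)} fun i hi => hi
  have hx : IsCorePoint R (x₀ + z) := by
    simpa using (isCorePoint_of_mem_relInterior hx₀).smul_add hz.1 one_pos
  have hxC : x₀ + z ∈ D.chamber := D.chamber.add_mem hx₀C hz.2
  have hpos : ∀ y ∈ R ⊓ D.chamber, ∀ j, (x₀ + z) (D.coroot j) = 0 → y (D.coroot j) = 0 := by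
    intro y hy j hj
    by_contra hne
    have h1 := hz' j ⟨y, hy, (hy.2 j).lt_of_ne' hne⟩
    have h2 := hx₀C j
    rw [LinearMap.add_apply] at hj
    linarith
  generalize x₀ + z = x at hx hxC hpos
  refine ⟨x, hx, hxC, fun i hi => (hxC i).lt_of_ne' fun hi0 => hi fun y hy => ?_⟩
  -- Move `y` by the group of the reflections fixing `x`. Then `N x + w y` lies in `R ∩ C̄` for
  -- large `N`, so `w y` vanishes on all `hⱼ` vanishing at `x`; thus `w` fixes it and `y = w y`.
  obtain ⟨w, hw, hwy⟩ := hD.exists_restrict_nonneg {j | x (D.coroot j) = 0} (hYX (hface.le hy))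
  have hmap : R.map w.toLinearMap = R := map_eq_of_mem_restrict_group
    (fun j hj => map_reflection_eq hYW hface hx hj) hw
  have hwR : w y ∈ R := hmap.le ⟨y, hy, rfl⟩
  have hev : ∀ᶠ N : ℝ in Filter.atTop, ∀ j, 0 ≤ (N • x + w y) (D.coroot j) := by
    refine Filter.eventually_all.2 fun j => ?_
    simp only [LinearMap.add_apply, LinearMap.smul_apply, smul_eq_mul]
    by_cases hj : x (D.coroot j) = 0
    · rw [hj]
      simpa only [mul_zero, zero_add] using Filter.Eventually.of_forall fun _ => hwy j hj
    · exact (eventually_atTop_pos_mul_add ((hxC j).lt_of_ne' hj) _).mono fun _ h => h.le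
  obtain ⟨N, hN, hN0⟩ := (hev.and (Filter.eventually_ge_atTop 0)).exists
  have hzero : ∀ j ∈ {j | x (D.coroot j) = 0}, w y (D.coroot j) = 0 := by
    intro j hj
    have h1 := hpos _ ⟨R.add_mem (R.smul_mem hN0 hx.1) hwR, hN⟩ j hj
    rwa [LinearMap.add_apply, LinearMap.smul_apply, show x (D.coroot j) = 0 from hj, smul_zero,
      zero_add] at h1
  have hfix := apply_eq_of_mem_restrict_group hzero (inv_mem hw)
  rw [show w⁻¹ (w y) = y from w.symm_apply_apply y] at hfix
  rw [← hfix] at hzero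
  exact D.reflection_apply_eq_self (hzero i hi0)

/-- An index outside both types of a face in the cross section is nonnegative on the face. -/
theorem nonneg_of_notMem_types (hD : D.IsLinearCoxeterSystem)
    {Y : PointedCone ℝ (Module.Dual ℝ V)} (hYX : (Y : Set (Module.Dual ℝ V)) ⊆ D.titsCone)
    (hYW : ∀ σ ∈ D.group, Y.map σ.toLinearMap = Y) {R : PointedCone ℝ (Module.Dual ℝ V)}
    (hR : R ∈ D.crossSection Y) {i : ι} (hl : i ∉ D.lowerType R) (hu : i ∉ D.upperType R)
    {y : Module.Dual ℝ V} (hy : y ∈ R) : 0 ≤ y (D.coroot i) := by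
  obtain ⟨x, hx, _, hpos⟩ := exists_isCorePoint hD hYX hYW hR
  by_contra! hneg
  have hxi := hpos i hl
  -- The combination `x(hᵢ) y - y(hᵢ) x` is again relatively interior and is annihilated by `hᵢ`.
  refine hu ⟨map_reflection_eq hYW hR.1 (hx.smul_add (R.smul_mem hxi.le hy)
    (neg_pos.2 hneg)) ?_, hl⟩
  rw [LinearMap.add_apply, LinearMap.smul_apply, LinearMap.smul_apply, smul_eq_mul, smul_eq_mul]
  ring

theorem coneSub_inter_chamber_subset (hD : D.IsLinearCoxeterSystem)
    {Y : PointedCone ℝ (Module.Dual ℝ V)} (hYX : (Y : Set (Module.Dual ℝ V)) ⊆ D.titsCone)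
    (hYW : ∀ σ ∈ D.group, Y.map σ.toLinearMap = Y) {R₁ R₂ : PointedCone ℝ (Module.Dual ℝ V)}
    (hR₁ : R₁ ∈ D.crossSection Y) (hR₂ : R₂ ∈ D.crossSection Y) (hR : R₁ ≤ R₂) :
    (coneSub R₂ R₁ : Set (Module.Dual ℝ V)) ∩
        (D.restrict (D.lowerType R₁ ∩ D.upperType R₂)).chamber ⊆
      ((R₂ : Set (Module.Dual ℝ V)) ∩ D.chamber) - ((R₁ : Set (Module.Dual ℝ V)) ∩ D.chamber) := by
  rintro _ ⟨⟨a, ha, b, hb, rfl⟩, hab⟩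
  change a - b ∈ (D.restrict (D.lowerType R₁ ∩ D.upperType R₂)).chamber at hab
  obtain ⟨x, hx, hxC, hpos⟩ := exists_isCorePoint hD hYX hYW hR₁
  have hev : ∀ᶠ N : ℝ in Filter.atTop, ∀ i, 0 ≤ (N • x + (a - b)) (D.coroot i) := by
    refine Filter.eventually_all.2 fun i => ?_
    simp only [LinearMap.add_apply, LinearMap.smul_apply, smul_eq_mul]
    by_cases hi : i ∈ D.lowerType R₁
    · have h : 0 ≤ (a - b) (D.coroot i) := by
        by_cases hu : i ∈ D.upperType R₂
        · exact hab ⟨i, hi, hu⟩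
        rw [LinearMap.sub_apply, apply_coroot_eq_zero_of_mem_lowerType hi hb, sub_zero]
        by_cases hl : i ∈ D.lowerType R₂
        · exact (apply_coroot_eq_zero_of_mem_lowerType hl ha).ge
        · exact nonneg_of_notMem_types hD hYX hYW hR₂ hl hu ha
      filter_upwards [Filter.eventually_ge_atTop 0] with N hN
      exact add_nonneg (mul_nonneg hN (hxC i)) h
    · exact (eventually_atTop_pos_mul_add (hpos i hi) _).mono fun _ h => h.le
  -- Besides reaching the chamber, `N` is large enough that `N x - b ∈ R₁`, which keeps `N x + (a -
  -- b)` in `R₂`.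
  obtain ⟨N, ⟨hN, hNb⟩, hN0⟩ :=
    ((hev.and (hx.2 b hb)).and (Filter.eventually_ge_atTop 0)).exists
  refine ⟨N • x + (a - b), ⟨?_, hN⟩, N • x,
    ⟨R₁.smul_mem hN0 hx.1, D.chamber.smul_mem hN0 hxC⟩, add_sub_cancel_left _ _⟩
  have h := R₂.add_mem ha (hR hNb)
  rwa [add_sub_left_comm] at h

end RayDatum

end LinCox

theorem mainTheorem7 {ι V : Type*} [Finite ι] [AddCommGroup V] [Module ℝ V]
    [FiniteDimensional ℝ V]
    (D : LinCox.RayDatum ι V) (hD : D.IsLinearCoxeterSystem)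
    (Y : PointedCone ℝ (Module.Dual ℝ V))
    (hYX : (Y : Set (Module.Dual ℝ V)) ⊆ D.titsCone)
    (hYW : ∀ σ ∈ D.group, Y.map σ.toLinearMap = Y)
    (R₁ R₂ : PointedCone ℝ (Module.Dual ℝ V))
    (hR₁ : R₁ ∈ D.crossSection Y) (hR₂ : R₂ ∈ D.crossSection Y) (hR : R₁ ≤ R₂)
    (J : Set ι) (hJ : J = D.lowerType R₁ ∩ D.upperType R₂) :
    -- `R₂ - R₁` is a `W_J`-invariant convex subcone of `X(J)`
    ((LinCox.coneSub R₂ R₁ : Set (Module.Dual ℝ V)) ⊆ (D.restrict J).titsCone ∧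
      ∀ σ ∈ (D.restrict J).group,
        (LinCox.coneSub R₂ R₁).map σ.toLinearMap = LinCox.coneSub R₂ R₁) ∧
    -- its intersection with `C̄(J)`
    ((LinCox.coneSub R₂ R₁ : Set (Module.Dual ℝ V)) ∩ (D.restrict J).chamber =
        ((R₂ : Set (Module.Dual ℝ V)) ∩ D.chamber) +
          ((R₁ : Set (Module.Dual ℝ V)) - (R₁ : Set (Module.Dual ℝ V))) ∧
      (LinCox.coneSub R₂ R₁ : Set (Module.Dual ℝ V)) ∩ (D.restrict J).chamber =
        ((R₂ : Set (Module.Dual ℝ V)) ∩ D.chamber) -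
          ((R₁ : Set (Module.Dual ℝ V)) ∩ D.chamber)) ∧
    -- `R ↦ R - R₁` is an isomorphism of partially ordered sets, equivariant, dimension preserving
    ∃ φ : LinCox.faceInterval Y R₁ R₂ ≃o LinCox.faces (LinCox.coneSub R₂ R₁),
      (∀ R, (φ R : PointedCone ℝ (Module.Dual ℝ V)) = LinCox.coneSub R R₁) ∧
      (∀ σ ∈ (D.restrict J).group, ∀ R : LinCox.faceInterval Y R₁ R₂,
        ∃ hσR : (R : PointedCone ℝ (Module.Dual ℝ V)).map σ.toLinearMap ∈
            LinCox.faceInterval Y R₁ R₂,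
          (φ ⟨_, hσR⟩ : PointedCone ℝ (Module.Dual ℝ V)) =
            (φ R : PointedCone ℝ (Module.Dual ℝ V)).map σ.toLinearMap) ∧
      (∀ R, LinCox.coneDim (φ R : PointedCone ℝ (Module.Dual ℝ V)) =
        LinCox.coneDim (R : PointedCone ℝ (Module.Dual ℝ V))) := by
  subst hJ
  set J := D.lowerType R₁ ∩ D.upperType R₂
  have hzero : ∀ j ∈ J, ∀ x ∈ R₁, x (D.coroot j) = 0 := fun j hj x hx =>
    LinCox.RayDatum.apply_coroot_eq_zero_of_mem_lowerType hj.1 hx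
  have hfix : ∀ σ ∈ (D.restrict J).group, ∀ x ∈ R₁, σ x = x := fun σ hσ x hx =>
    LinCox.RayDatum.apply_eq_of_mem_restrict_group (fun j hj => hzero j hj x hx) hσ
  have hmap₁ : ∀ σ ∈ (D.restrict J).group, R₁.map σ.toLinearMap = R₁ := fun σ hσ =>
    LinCox.RayDatum.map_eq_of_forall_apply_eq (hfix σ hσ)
  have hmap₂ : ∀ σ ∈ (D.restrict J).group, R₂.map σ.toLinearMap = R₂ := fun σ hσ =>
    LinCox.RayDatum.map_eq_of_mem_restrict_group (fun j hj => hj.2.1) hσ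
  have h13 := LinCox.RayDatum.coneSub_inter_chamber_subset hD hYX hYW hR₁ hR₂ hR
  have h32 : ((R₂ : Set (Module.Dual ℝ V)) ∩ D.chamber) -
      ((R₁ : Set (Module.Dual ℝ V)) ∩ D.chamber) ⊆ ((R₂ : Set (Module.Dual ℝ V)) ∩ D.chamber) +
        ((R₁ : Set (Module.Dual ℝ V)) - (R₁ : Set (Module.Dual ℝ V))) := by
    rintro _ ⟨a, ha, b, hb, rfl⟩
    exact ⟨a, ha, 0 - b, ⟨0, R₁.zero_mem, b, hb.1, rfl⟩, by
      simp only [zero_sub]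
      exact (sub_eq_add_neg a b).symm⟩
  have h21 : ((R₂ : Set (Module.Dual ℝ V)) ∩ D.chamber) +
      ((R₁ : Set (Module.Dual ℝ V)) - (R₁ : Set (Module.Dual ℝ V))) ⊆
      (LinCox.coneSub R₂ R₁ : Set (Module.Dual ℝ V)) ∩ (D.restrict J).chamber := by
    rintro _ ⟨a, ha, _, ⟨b, hb, c, hc, rfl⟩, rfl⟩
    refine ⟨⟨a + b, R₂.add_mem ha.1 (hR hb), c, hc, add_sub_assoc a b c⟩, fun j => ?_⟩
    change 0 ≤ a (D.coroot j) + (b (D.coroot j) - c (D.coroot j))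
    rw [hzero j j.2 b hb, hzero j j.2 c hc, sub_zero, add_zero]
    exact ha.2 j
  refine ⟨⟨?_, fun σ hσ => ?_⟩, ⟨(h13.trans h32).antisymm h21, h13.antisymm (h32.trans h21)⟩,
    LinCox.faceIntervalEquiv hR₂.1 hR, fun R => rfl, fun σ hσ R => ?_,
    fun R => LinCox.coneDim_coneSub R.2.2.1⟩
  · rintro _ ⟨a, ha, b, hb, rfl⟩
    -- Only `a` has to be moved: `v` fixes `b`, and `b` vanishes on each `hⱼ`.
    obtain ⟨v, hv, hva⟩ := hD.exists_restrict_nonneg J (hYX (hR₂.1.le ha))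
    refine Set.mem_iUnion₂.2 ⟨v⁻¹, inv_mem hv, v (a - b), fun j => ?_, v.symm_apply_apply _⟩
    change 0 ≤ v (a - b) (D.coroot j)
    rw [map_sub, hfix v hv b hb, LinearMap.sub_apply, hzero j j.2 b hb, sub_zero]
    exact hva j j.2
  · rw [LinCox.map_coneSub, hmap₁ σ hσ, hmap₂ σ hσ]
  · have hY := hYW σ (D.group_restrict_le J hσ)
    have hface := PointedCone.IsFaceOf.map_equiv σ R.2.1
    rw [show PointedCone.map _ Y = Y from hY] at hface
    refine ⟨⟨hface, ?_, ?_⟩, ?_⟩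
    · exact (hmap₁ σ hσ).ge.trans (Submodule.map_mono R.2.2.1)
    · exact le_trans (Submodule.map_mono R.2.2.2) (hmap₂ σ hσ).le
    · exact (congrArg _ (hmap₁ σ hσ)).symm.trans (LinCox.map_coneSub σ.toLinearMap R R₁).symm
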